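/- A nondeterministic finite automaton (NFA) here has a finite state set, a single initial state, no $\lambda$-moves, and it accepts a word if at least one path for the word (a sequence of states that starts in the initial state and follows the transition function) ends in an accepting state. An exclusive nondeterministic finite automaton (XNFA) is the same device, except that a word is accepted if and only if exactly one path for it ends in an accepting state. An automaton is unary if its input alphabet is a singleton $\{a\}$. Proposition. For the conversion of unary NFAs to equivalent XNFAs, $e^{\Theta(\sqrt{n\ln n})}$ states are sufficient, and this bound is tight in the order of magnitude: there are a function $f:\mathbb N\to\mathbb N$ and constants $c,C>0$ with $$e^{c\sqrt{n\ln n}}\le f(n)\le e^{C\sqrt{n\ln n}}\qquad\text{for all } n\ge 2,$$ such that for every $n\ge 2$: (i) for every unary $n$-state NFA $M$ there is a unary XNFA with at most $f(n)$ states that accepts $L(M)$; and (ii) there is a unary $n$-state NFA $M$ such that every unary XNFA accepting $L(M)$ has at least $f(n)$ states. -/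

import Mathlib

namespace NFA

/-- The automaton has exactly one initial state. -/
def HasSingleStart {α σ : Type*} (M : NFA α σ) : Prop :=
  ∃ q₀ : σ, M.start = {q₀}

/-- The language accepted by `M` viewed as an exclusive nondeterministic finite automaton (XNFA):
a word is accepted iff *exactly one* path for it, from the initial state, ends in an accepting
state. A path is determined by its sequence of states (`NFA.Path`). -/
def exclusiveAccepts {α σ : Type*} (M : NFA α σ) : Language α :=
  {w | ∃! p : (Σ s : σ, Σ t : σ, M.Path s t w), p.1 ∈ M.start ∧ p.2.1 ∈ M.accept}

end NFA

/-! Take `f n` to be the least number of XNFA states that always suffices; (ii) is then minimality,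
and only the two bounds on `f n` need work. Upper bound: a DFA is an XNFA, so it is enough to count
the reachable subsets of `M`. A walk of at least `n` steps meets a cycle, hence a strongly connected
component with a closed walk of length its girth; so the subsets have preperiod at most `2n²` and
period any common multiple `L` of the girths (`StepsTo.of_modEq`). Component sizes sum to `n`, so `L
≤ lcm(1..T) * n^d` with `d ≤ n / T`, and `T ≈ √(n ln n)` balances the factors. Lower bound: disjoint
cycles of prime lengths accept all positive lengths not divisible by their product `N`. By
Cayley–Hamilton, the number of accepting paths of an `m`-state XNFA satisfies a monic recurrence of
order `m`. It equals `1` on `1, ..., N - 1` but not at `N`, so `m ≥ N - 1`. Chebyshev bounds give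
the size of `N`. -/

/-- `StepsTo r k x y` says that `y` is reached from `x` by exactly `k` steps of `r`. -/
def StepsTo {σ : Type*} (r : σ → σ → Prop) : ℕ → σ → σ → Prop
  | 0, x, y => x = y
  | k + 1, x, y => ∃ z, r x z ∧ StepsTo r k z y

/-! ### Walks: pigeonhole and cutting -/

namespace StepsTo

variable {σ : Type*} {r : σ → σ → Prop}

theorem trans {a b : ℕ} {x y z : σ} (h₁ : StepsTo r a x y) (h₂ : StepsTo r b y z) :
    StepsTo r (a + b) x z := by
  induction a generalizing x with
  | zero => cases h₁; simpa using h₂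
  | succ a ih =>
    obtain ⟨w, hw, h⟩ := h₁
    rw [Nat.succ_add]
    exact ⟨w, hw, ih h⟩

theorem iterate {a : ℕ} {x : σ} (h : StepsTo r a x x) (t : ℕ) : StepsTo r (t * a) x x := by
  induction t with
  | zero => rw [zero_mul]; rfl
  | succ t ih => rw [Nat.succ_mul]; exact ih.trans h

theorem exists_vertices {k : ℕ} {x y : σ} (h : StepsTo r k x y) :
    ∃ v : Fin (k + 1) → σ, (∀ i : Fin (k + 1), StepsTo r i x (v i) ∧ StepsTo r (k - i) (v i) y) ∧
      ∀ i j : Fin (k + 1), i ≤ j → StepsTo r (j - i) (v i) (v j) := by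
  induction k generalizing x with
  | zero =>
    cases h
    exact ⟨fun _ => y, fun i => by simp [StepsTo], fun i j _ => by
      simp [StepsTo]⟩
  | succ k ih =>
    have h' := h
    obtain ⟨z, hz, h⟩ := h
    obtain ⟨v, hv, hvv⟩ := ih h
    refine ⟨Fin.cons x v, fun i => ?_, fun i j hij => ?_⟩
    · induction i using Fin.cases with
      | zero => exact ⟨rfl, h'⟩
      | succ i =>
        refine ⟨⟨z, hz, (hv i).1⟩, ?_⟩
        simpa using (hv i).2
    · induction j using Fin.cases with
      | zero =>
        obtain rfl := Fin.le_zero_iff.mp hij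
        simp [StepsTo]
      | succ j =>
        induction i using Fin.cases with
        | zero => exact ⟨z, hz, (hv j).1⟩
        | succ i => simpa using hvv i j (Fin.succ_le_succ_iff.mp hij)

theorem exists_loop_of_card_le [Fintype σ] {k : ℕ} {x y : σ} (h : StepsTo r k x y)
    (hk : Fintype.card σ ≤ k) :
    ∃ i ≤ k, ∃ c > 0, ∃ z, StepsTo r i x z ∧ StepsTo r c z z ∧ StepsTo r (k - i) z y := by
  obtain ⟨v, hv, hvv⟩ := h.exists_vertices
  have key : ∀ i j : Fin (k + 1), i < j → v i = v j →
      ∃ i ≤ k, ∃ c > 0, ∃ z, StepsTo r i x z ∧ StepsTo r c z z ∧ StepsTo r (k - i) z y := by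
    intro i j hij he
    have h := hvv i j hij.le
    rw [← he] at h
    exact ⟨i, Nat.lt_succ_iff.mp i.2, j - i, Nat.sub_pos_of_lt hij, v i, (hv i).1, h, (hv i).2⟩
  obtain ⟨i, j, hne, he⟩ := Fintype.exists_ne_map_eq_of_card_lt v (by
    simp only [Fintype.card_fin]; omega)
  rcases lt_or_gt_of_ne hne with hlt | hlt
  · exact key i j hlt he
  · exact key j i hlt he.symm

/-- Pigeonhole on pairs (vertex, time mod `l`): cutting between two equal pairs removes a multiple
of `l` steps. -/
theorem exists_short_modEq [Fintype σ] {l : ℕ} (hl : 0 < l) {a : ℕ} {x y : σ}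
    (h : StepsTo r a x y) :
    ∃ a' < Fintype.card σ * l, a' ≡ a [MOD l] ∧ StepsTo r a' x y := by
  induction a using Nat.strong_induction_on with
  | _ a ih =>
    by_cases ha : a < Fintype.card σ * l
    · exact ⟨a, ha, rfl, h⟩
    obtain ⟨v, hv, -⟩ := h.exists_vertices
    let g : Fin (a + 1) → σ × Fin l := fun i => (v i, ⟨i % l, Nat.mod_lt _ hl⟩)
    have hcut : ∀ i j : Fin (a + 1), i < j → g i = g j →
        ∃ a' < Fintype.card σ * l, a' ≡ a [MOD l] ∧ StepsTo r a' x y := by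
      intro i j hij hg
      simp only [g, Prod.mk.injEq, Fin.mk.injEq] at hg
      have hj : (j : ℕ) ≤ a := Nat.lt_succ_iff.mp j.2
      have hij' : (i : ℕ) < j := hij
      obtain ⟨a', h₁, h₂, h₃⟩ := ih (i + (a - j)) (by omega)
        ((hv i).1.trans (by rw [hg.1]; exact (hv j).2))
      refine ⟨a', h₁, h₂.trans ?_, h₃⟩
      have : (i : ℕ) + (a - j) ≡ j + (a - j) [MOD l] := Nat.ModEq.add_right _ hg.2
      rwa [Nat.add_sub_cancel' hj] at this
    obtain ⟨i, j, hne, hg⟩ := Fintype.exists_ne_map_eq_of_card_lt g (by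
      simp only [Fintype.card_prod, Fintype.card_fin]; omega)
    rcases lt_or_gt_of_ne hne with hlt | hlt
    · exact hcut i j hlt hg
    · exact hcut j i hlt hg.symm

end StepsTo

/-! ### Strongly connected components and the period -/

section Components

variable {σ : Type*} (r : σ → σ → Prop)

/-- Mutual reachability. -/
def mutualReachSetoid : Setoid σ where
  r x y := (∃ a, StepsTo r a x y) ∧ ∃ b, StepsTo r b y x
  iseqv :=
    { refl := fun _ => ⟨⟨0, rfl⟩, ⟨0, rfl⟩⟩
      symm := fun h => ⟨h.2, h.1⟩
      trans := fun ⟨⟨_, h₁⟩, ⟨_, h₂⟩⟩ ⟨⟨_, h₃⟩, ⟨_, h₄⟩⟩ =>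
        ⟨⟨_, h₁.trans h₃⟩, ⟨_, h₄.trans h₂⟩⟩ }

/-- The strongly connected components of `r`. -/
abbrev StrongComponent := Quotient (mutualReachSetoid r)

variable {r}

open Classical in
/-- The length of a shortest closed walk through the representative of a component, and `1` if
there is none. -/
noncomputable def StrongComponent.girth (q : StrongComponent r) : ℕ :=
  -- The default `1` divides every `L` and never exceeds the size of the component.
  if h : ∃ m, 0 < m ∧ StepsTo r m q.out q.out then Nat.find h else 1

/-- The number of vertices of a component. -/
noncomputable def StrongComponent.size (q : StrongComponent r) : ℕ :=
  Nat.card {x : σ // (⟦x⟧ : StrongComponent r) = q}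

theorem StrongComponent.girth_pos (q : StrongComponent r) : 0 < q.girth := by
  classical
  unfold girth
  split_ifs with h
  · exact (Nat.find_spec h).1
  · exact one_pos

theorem StrongComponent.stepsTo_girth (q : StrongComponent r) {m : ℕ} (hm : 0 < m)
    (h : StepsTo r m q.out q.out) : StepsTo r q.girth q.out q.out := by
  classical
  have h' : ∃ m, 0 < m ∧ StepsTo r m q.out q.out := ⟨m, hm, h⟩
  unfold girth
  rw [dif_pos h']
  exact (Nat.find_spec h').2

/-- A shortest closed walk stays inside its component and repeats no vertex before closing. -/
theorem StrongComponent.girth_le_size [Finite σ] (q : StrongComponent r) : q.girth ≤ q.size := by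
  classical
  unfold girth
  split_ifs with h
  · obtain ⟨h₀, h₁⟩ := Nat.find_spec h
    have hmin : ∀ c, 0 < c → StepsTo r c q.out q.out → Nat.find h ≤ c := fun c hc hs =>
      Nat.find_min' h ⟨hc, hs⟩
    generalize Nat.find h = m at h₀ h₁ hmin
    obtain ⟨v, hv, -⟩ := h₁.exists_vertices
    have hmem : ∀ i, (⟦v i⟧ : StrongComponent r) = q := fun i => by
      conv_rhs => rw [← q.out_eq]
      exact Quotient.sound ⟨⟨_, (hv i).2⟩, ⟨_, (hv i).1⟩⟩
    have hinj : Function.Injective fun i : Fin m =>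
        (⟨v i.castSucc, hmem _⟩ : {x : σ // (⟦x⟧ : StrongComponent r) = q}) := by
      have key : ∀ i j : Fin m, i < j → v i.castSucc ≠ v j.castSucc := by
        intro i j hij he
        have hij' : (i : ℕ) < j := hij
        have h₂ : StepsTo r (i + (m - j)) q.out q.out :=
          (hv i.castSucc).1.trans (by rw [he]; exact (hv j.castSucc).2)
        have := hmin _ (by have := j.2; omega) h₂
        omega
      intro i j hij
      simp only [Subtype.mk.injEq] at hij
      by_contra hne
      rcases lt_or_gt_of_ne hne with hlt | hlt
      · exact key i j hlt hij
      · exact key j i hlt hij.symm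
    simpa [size] using Nat.card_le_card_of_injective _ hinj
  · have : Nonempty {x : σ // (⟦x⟧ : StrongComponent r) = q} := ⟨⟨q.out, q.out_eq⟩⟩
    exact Nat.card_pos

/-- If `L` is a common multiple of the girths of all components, reachability in at least `2n²`
steps depends only on the number of steps modulo `L`. -/
theorem StepsTo.of_modEq [Fintype σ] {L : ℕ} (hL : ∀ q : StrongComponent r, q.girth ∣ L)
    {k k' : ℕ} (hk : Fintype.card σ ≤ k) (hk' : 2 * Fintype.card σ ^ 2 ≤ k')
    (hkk : k ≡ k' [MOD L]) {x y : σ} (h : StepsTo r k x y) : StepsTo r k' x y := by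
  obtain ⟨i, hi, c, hc, z, h₁, h₂, h₃⟩ := h.exists_loop_of_card_le hk
  set q : StrongComponent r := ⟦z⟧ with hq
  have hz : (mutualReachSetoid r) z q.out := Quotient.exact (by rw [q.out_eq])
  obtain ⟨⟨d₁, hd₁⟩, ⟨d₂, hd₂⟩⟩ := hz
  have hloop : StepsTo r q.girth q.out q.out :=
    q.stepsTo_girth (m := d₂ + c + d₁) (by omega) ((hd₂.trans h₂).trans hd₁)
  have hl := q.girth_pos
  have hA := h₁.trans hd₁
  -- With the detour between `z` and `q.out` made `girth` times in all, the added length vanishes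
  -- modulo the girth. Each half then shrinks below `n * girth ≤ n²`, and loops at `q.out` fill the
  -- gap up to `k'`.
  have hB := (hd₂.trans ((hd₁.trans hd₂).iterate (q.girth - 1))).trans h₃
  obtain ⟨A, hAlt, hAmod, hA⟩ := hA.exists_short_modEq hl
  obtain ⟨B, hBlt, hBmod, hB⟩ := hB.exists_short_modEq hl
  have hsize : q.girth ≤ Fintype.card σ := q.girth_le_size.trans (by
    rw [← Nat.card_eq_fintype_card]
    exact Nat.card_le_card_of_injective _ Subtype.val_injective)
  have hle : A + B ≤ k' := by
    have := Nat.mul_le_mul_left (Fintype.card σ) hsize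
    nlinarith
  have hmod : A + B ≡ k' [MOD q.girth] := by
    refine (hAmod.add hBmod).trans (Nat.ModEq.trans ?_ (hkk.of_dvd (hL q)))
    have : i + d₁ + (d₂ + (q.girth - 1) * (d₁ + d₂) + (k - i)) = k + q.girth * (d₁ + d₂) := by
      obtain ⟨l, hl'⟩ : ∃ l, q.girth = l + 1 := ⟨q.girth - 1, by omega⟩
      obtain ⟨j, rfl⟩ := Nat.exists_eq_add_of_le hi
      rw [hl', Nat.add_sub_cancel, Nat.add_sub_cancel_left]
      ring
    rw [this]
    exact Nat.modEq_iff_dvd' (by omega) |>.mpr (by simp) |>.symm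
  obtain ⟨t, ht⟩ := (Nat.modEq_iff_dvd' hle).mp hmod
  have := (hA.trans (hloop.iterate t)).trans hB
  rwa [show A + t * q.girth + B = k' by rw [mul_comm]; omega] at this

theorem StrongComponent.sum_size [Fintype σ] [Fintype (StrongComponent r)] :
    ∑ q : StrongComponent r, q.size = Fintype.card σ := by
  rw [← Nat.card_eq_fintype_card, ← Nat.card_congr
    (Equiv.sigmaFiberEquiv fun x : σ => (⟦x⟧ : StrongComponent r)), Nat.card_sigma]
  rfl

/-- A common multiple of all girths: the small ones divide `lcmUpto T`, and there are at most `n/T`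
large ones. -/
theorem StrongComponent.exists_common_multiple [Fintype σ] (r : σ → σ → Prop) (T : ℕ) :
    ∃ L d : ℕ, 0 < L ∧ (∀ q : StrongComponent r, q.girth ∣ L) ∧ d * T ≤ Fintype.card σ ∧
      L ≤ Nat.lcmUpto T * Fintype.card σ ^ d := by
  classical
  have : Fintype (StrongComponent r) := Fintype.ofFinite _
  -- Large components are selected by size rather than girth, because sizes sum to `n`.
  let s : Finset (StrongComponent r) := Finset.univ.filter fun q => T < q.size
  have hcard : ∀ q : StrongComponent r, q.size ≤ Fintype.card σ := fun q => by
    rw [← StrongComponent.sum_size (r := r)]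
    exact Finset.single_le_sum (f := fun q : StrongComponent r => q.size)
      (fun _ _ => Nat.zero_le _) (Finset.mem_univ q)
  refine ⟨Nat.lcmUpto T * ∏ q ∈ s, q.girth, s.card,
    Nat.mul_pos (Nat.lcmUpto_pos T) (Finset.prod_pos fun q _ => q.girth_pos), fun q => ?_, ?_, ?_⟩
  · by_cases hq : T < q.size
    · exact (Finset.dvd_prod_of_mem _ (by simpa [s] using hq)).mul_left _
    · exact Dvd.dvd.mul_right (Finset.dvd_lcm (f := id) (Finset.mem_Icc.mpr
        ⟨q.girth_pos, q.girth_le_size.trans (not_lt.mp hq)⟩)) _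
  · rw [← StrongComponent.sum_size (r := r), ← smul_eq_mul]
    exact (Finset.card_nsmul_le_sum s _ T fun q hq => (Finset.mem_filter.mp hq).2.le).trans
      (Finset.sum_le_sum_of_subset (Finset.subset_univ s))
  · exact Nat.mul_le_mul_left _
      (Finset.prod_le_pow_card _ _ _ fun q _ => q.girth_le_size.trans (hcard q))

end Components

/-! ### Determinization as an XNFA -/

namespace DFA

variable {α τ : Type*}

theorem toNFA_exclusiveAccepts (D : DFA α τ) : D.toNFA.exclusiveAccepts = D.accepts := by
  have hsub : ∀ (w : List α) (s : τ) (p q : Σ t, D.toNFA.Path s t w), p = q := by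
    intro w
    induction w with
    | nil => rintro s ⟨_, ⟨⟩⟩ ⟨_, ⟨⟩⟩; rfl
    | cons a w ih =>
      rintro s ⟨t, p₀⟩ ⟨t', p₀'⟩
      cases p₀ with | cons _ _ _ _ _ h p => ?_
      cases p₀' with | cons _ _ _ _ _ h' p' => ?_
      obtain rfl := Set.mem_singleton_iff.mp h
      obtain rfl := Set.mem_singleton_iff.mp h'
      have := ih _ ⟨t, p⟩ ⟨t', p'⟩
      simp only [Sigma.mk.injEq] at this
      obtain ⟨rfl, this⟩ := this
      obtain rfl := eq_of_heq this
      rfl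
  rw [← D.toNFA_correct]
  ext w
  rw [NFA.accepts_iff_exists_path]
  constructor
  · rintro ⟨⟨s, t, p⟩, ⟨hs, ht⟩, -⟩
    exact ⟨s, hs, t, ht, ⟨p⟩⟩
  · rintro ⟨s, hs, t, ht, ⟨p⟩⟩
    refine ⟨⟨s, t, p⟩, ⟨hs, ht⟩, ?_⟩
    rintro ⟨s', t', p'⟩ ⟨hs', -⟩
    obtain rfl := Set.mem_singleton_iff.mp hs
    obtain rfl := Set.mem_singleton_iff.mp hs'
    rw [hsub w _ ⟨t, p⟩ ⟨t', p'⟩]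

end DFA

namespace NFA

theorem list_unit_eq_replicate (w : List Unit) : w = List.replicate w.length () :=
  List.eq_replicate_iff.mpr ⟨rfl, fun _ _ => rfl⟩

theorem mem_evalFrom_replicate {σ : Type*} (M : NFA Unit σ) (S : Set σ) (k : ℕ) (y : σ) :
    y ∈ M.evalFrom S (List.replicate k ()) ↔
      ∃ x ∈ S, StepsTo (fun x z => z ∈ M.step x ()) k x y := by
  induction k generalizing S with
  | zero => simp [StepsTo]
  | succ k ih =>
    rw [List.replicate_succ, evalFrom_cons, ih]
    simp only [mem_stepSet, StepsTo]
    grind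

theorem exists_XNFA {σ : Type} [Fintype σ] (M : NFA Unit σ) (T : ℕ) :
    ∃ (L d : ℕ), 0 < L ∧ d * T ≤ Fintype.card σ ∧ L ≤ Nat.lcmUpto T * Fintype.card σ ^ d ∧
      ∃ (τ : Type) (_ : Fintype τ) (X : NFA Unit τ), X.HasSingleStart ∧
        Fintype.card τ ≤ 2 * Fintype.card σ ^ 2 + L ∧ X.exclusiveAccepts = M.accepts := by
  classical
  obtain ⟨L, d, hL, hdvd, hd, hle⟩ :=
    StrongComponent.exists_common_multiple (fun x z => z ∈ M.step x ()) T
  refine ⟨L, d, hL, hd, hle, ?_⟩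
  let S : ℕ → Set σ := fun k => M.eval (List.replicate k ())
  have hS : ∀ k, M.stepSet (S k) () = S (k + 1) := fun k => by
    simp only [S, List.replicate_succ', eval_append_singleton]
  set N := 2 * Fintype.card σ ^ 2
  have hN : Fintype.card σ ≤ N := by
    have := Nat.le_self_pow two_ne_zero (Fintype.card σ)
    omega
  have hper : ∀ k, N ≤ k → S (k + L) = S k := by
    intro k hk
    ext y
    simp only [S, eval, mem_evalFrom_replicate]
    have hmod : k + L ≡ k [MOD L] := by simp
    constructor <;> rintro ⟨x, hx, h⟩
    · exact ⟨x, hx, h.of_modEq hdvd (by omega) hk hmod⟩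
    · exact ⟨x, hx, h.of_modEq hdvd (by omega) (by omega) hmod.symm⟩
  have hrange : ∀ k, ∃ i : Fin (N + L), S i = S k := by
    intro k
    induction k using Nat.strong_induction_on with
    | _ k ih =>
      by_cases hk : k < N + L
      · exact ⟨⟨k, hk⟩, rfl⟩
      · obtain ⟨i, hi⟩ := ih (k - L) (by omega)
        refine ⟨i, hi.trans ?_⟩
        rw [← hper (k - L) (by omega), Nat.sub_add_cancel (by omega)]
  let D : DFA Unit (Set.range S) :=
    { step := fun s _ => ⟨M.stepSet s.1 (), by
        obtain ⟨_, k, rfl⟩ := s; exact ⟨k + 1, (hS k).symm⟩⟩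
      start := ⟨S 0, 0, rfl⟩
      accept := {s | ∃ t ∈ s.1, t ∈ M.accept} }
  have hsurj : Function.Surjective fun i : Fin (N + L) => (⟨S i, i, rfl⟩ : Set.range S) := by
    rintro ⟨_, k, rfl⟩
    obtain ⟨i, hi⟩ := hrange k
    exact ⟨i, Subtype.ext hi⟩
  refine ⟨Set.range S, Fintype.ofSurjective _ hsurj, D.toNFA, ⟨_, rfl⟩, ?_, ?_⟩
  · have := Nat.card_le_card_of_surjective _ hsurj
    rw [Nat.card_fin] at this
    rwa [← @Nat.card_eq_fintype_card _ (_)]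
  · rw [D.toNFA_exclusiveAccepts]
    have heval : ∀ k, (D.eval (List.replicate k ())).1 = S k := by
      intro k
      induction k with
      | zero => rfl
      | succ k ih =>
        rw [List.replicate_succ', DFA.eval_append_singleton, ← hS, ← ih]
    ext w
    rw [list_unit_eq_replicate w, DFA.mem_accepts, mem_accepts]
    change (∃ t ∈ (D.eval _).1, t ∈ M.accept) ↔ _
    rw [heval]
    exact ⟨fun ⟨t, h, h'⟩ => ⟨t, h', h⟩, fun ⟨t, h, h'⟩ => ⟨t, h', h⟩⟩

end NFA

/-! ### Counting accepting paths by a linear recurrence -/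

namespace NFA

/-- Splitting off the first step of a path. -/
def pathConsEquiv {α σ : Type*} (M : NFA α σ) (s u : σ) (a : α) (w : List α) :
    M.Path s u (a :: w) ≃ Σ t : M.step s a, M.Path t u w where
  toFun | .cons t _ _ _ _ h p => ⟨⟨t, h⟩, p⟩
  invFun q := .cons q.1.1 s u a w q.1.2 q.2
  left_inv := by rintro ⟨⟩; rfl
  right_inv := by rintro ⟨⟨_, _⟩, _⟩; rfl

variable {σ : Type*} [Fintype σ] [DecidableEq σ]

open Classical in
/-- The transition matrix of a unary automaton. -/
noncomputable def transitionMatrix (M : NFA Unit σ) : Matrix σ σ ℤ :=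
  Matrix.of fun s t => if t ∈ M.step s () then 1 else 0

/-- Finiteness is carried along because `Nat.card` of an infinite type is `0`. -/
theorem finite_path_and_card (M : NFA Unit σ) (k : ℕ) (s t : σ) :
    Finite (M.Path s t (List.replicate k ())) ∧
      (Nat.card (M.Path s t (List.replicate k ())) : ℤ) = (M.transitionMatrix ^ k) s t := by
  classical
  induction k generalizing s with
  | zero =>
    have hsub : Subsingleton (M.Path s t []) := ⟨by rintro ⟨⟩ ⟨⟩; rfl⟩
    refine ⟨inferInstanceAs (Finite (M.Path s t [])), ?_⟩
    change (Nat.card (M.Path s t []) : ℤ) = _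
    rw [pow_zero]
    by_cases h : s = t
    · subst h
      have : Nonempty (M.Path s s []) := ⟨.nil s⟩
      rw [Matrix.one_apply_eq, Nat.card_of_subsingleton (Classical.arbitrary _), Nat.cast_one]
    · have : IsEmpty (M.Path s t []) := ⟨by rintro ⟨⟩; exact h rfl⟩
      rw [Matrix.one_apply_ne h, Nat.card_of_isEmpty, Nat.cast_zero]
  | succ k ih =>
    have hfin := fun s => (ih s).1
    have e := M.pathConsEquiv s t () (List.replicate k ())
    refine ⟨Finite.of_equiv _ e.symm, ?_⟩
    rw [List.replicate_succ, Nat.card_congr e, Nat.card_sigma, pow_succ', Matrix.mul_apply]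
    push_cast
    simp only [(ih _).2, transitionMatrix, Matrix.of_apply, ite_mul, one_mul, zero_mul]
    rw [← Finset.sum_filter]
    exact (Finset.sum_subtype _ (by simp)
      (fun x => ((Matrix.of fun s t => if t ∈ M.step s () then (1 : ℤ) else 0) ^ k) x t)).symm

open Classical in
/-- The number of accepting paths of length `k` starting at `s`. -/
noncomputable def acceptingCount (M : NFA Unit σ) (s : σ) (k : ℕ) : ℤ :=
  ∑ t with t ∈ M.accept, (M.transitionMatrix ^ k) s t

theorem replicate_mem_exclusiveAccepts (M : NFA Unit σ) {s : σ} (hs : M.start = {s}) (k : ℕ) :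
    List.replicate k () ∈ M.exclusiveAccepts ↔ M.acceptingCount s k = 1 := by
  classical
  have hfin := fun t => (M.finite_path_and_card k s t).1
  have hcount : M.acceptingCount s k =
      Nat.card (Σ t : M.accept, M.Path s t (List.replicate k ())) := by
    rw [Nat.card_sigma, acceptingCount]
    push_cast
    simp only [(M.finite_path_and_card k s _).2]
    exact Finset.sum_subtype _ (by simp) (fun x => (M.transitionMatrix ^ k) s x)
  rw [hcount, Nat.cast_eq_one, Nat.card_eq_one_iff_exists]
  constructor
  · rintro ⟨⟨s', t, p⟩, ⟨hs', ht⟩, huniq⟩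
    dsimp only at hs' ht
    obtain rfl : s' = s := by rwa [hs] at hs'
    refine ⟨⟨⟨t, ht⟩, p⟩, ?_⟩
    rintro ⟨⟨t', ht'⟩, p'⟩
    have := huniq ⟨s', t', p'⟩ ⟨hs', ht'⟩
    simp only [Sigma.mk.injEq, heq_eq_eq, true_and] at this
    obtain ⟨rfl, this⟩ := this
    obtain rfl := eq_of_heq this
    rfl
  · rintro ⟨⟨⟨t, ht⟩, p⟩, huniq⟩
    refine ⟨⟨s, t, p⟩, ⟨by rw [hs]; rfl, ht⟩, ?_⟩
    rintro ⟨s', t', p'⟩ ⟨hs', ht'⟩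
    dsimp only at hs' ht' p'
    obtain rfl : s' = s := by rwa [hs] at hs'
    have := huniq ⟨⟨t', ht'⟩, p'⟩
    simp only [Sigma.mk.injEq, Subtype.mk.injEq] at this
    obtain ⟨rfl, this⟩ := this
    obtain rfl := eq_of_heq this
    rfl

/-- Cayley–Hamilton, multiplied by the `k`-th power of the matrix and summed over accepting states.
-/
theorem sum_charpoly_coeff_mul_acceptingCount (M : NFA Unit σ) (s : σ) (k : ℕ) :
    ∑ j ∈ Finset.range (Fintype.card σ + 1),
      M.transitionMatrix.charpoly.coeff j * M.acceptingCount s (k + j) = 0 := by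
  classical
  have h := M.transitionMatrix.aeval_self_charpoly
  rw [Polynomial.aeval_eq_sum_range, Matrix.charpoly_natDegree_eq_dim] at h
  have h' : ∀ t, ∑ j ∈ Finset.range (Fintype.card σ + 1),
      M.transitionMatrix.charpoly.coeff j * (M.transitionMatrix ^ (k + j)) s t = 0 := by
    intro t
    have h₂ := congrArg (fun B => (M.transitionMatrix ^ k * B) s t) h
    simpa only [Matrix.mul_sum, Matrix.mul_smul, ← pow_add, Matrix.sum_apply, Matrix.smul_apply,
      smul_eq_mul, mul_zero, Matrix.zero_apply] using h₂
  simp only [acceptingCount, Finset.mul_sum]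
  rw [Finset.sum_comm]
  exact Finset.sum_eq_zero fun t _ => h' t

end NFA

/-- A sequence subject to a monic linear recurrence of order `m` which is constant on `m + 1`
consecutive places is constant from there on. -/
theorem eq_of_linear_recurrence {m : ℕ} {b : ℕ → ℤ} {c : ℕ → ℤ} (hb : b m = 1)
    (hc : ∀ k, ∑ j ∈ Finset.range (m + 1), b j * c (k + j) = 0) {k₀ : ℕ}
    (hconst : ∀ i ≤ m, c (k₀ + i) = c k₀) (k : ℕ) : c (k₀ + k) = c k₀ := by
  have hd : ∀ k, c (k₀ + k + 1) = c (k₀ + k) := by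
    intro k
    induction k using Nat.strong_induction_on with
    | _ k ih =>
      by_cases hk : k + 1 ≤ m
      · rw [add_assoc, hconst _ hk, hconst _ (by omega)]
      -- Subtract two consecutive instances of the recurrence: the lower terms agree by induction,
      -- and the leading coefficient is `1`.
      have h₁ := hc (k₀ + (k - m) + 1)
      have h₀ := hc (k₀ + (k - m))
      rw [Finset.sum_range_succ, hb, one_mul] at h₀ h₁
      have : ∑ j ∈ Finset.range m, b j * c (k₀ + (k - m) + 1 + j) =
          ∑ j ∈ Finset.range m, b j * c (k₀ + (k - m) + j) := by
        refine Finset.sum_congr rfl fun j hj => ?_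
        have hj := Finset.mem_range.mp hj
        have := ih (k - m + j) (by omega)
        rw [show k₀ + (k - m) + 1 + j = k₀ + (k - m + j) + 1 by omega, this, add_assoc]
      rw [show k₀ + (k - m) + 1 + m = k₀ + k + 1 by omega] at h₁
      rw [show k₀ + (k - m) + m = k₀ + k by omega] at h₀
      linarith
  induction k with
  | zero => rfl
  | succ k ih => rw [← add_assoc, hd, ih]

/-! ### Automata that force many states -/

namespace NFA

/-- An XNFA accepting all lengths strictly between `0` and `N`, but not `N`, has at
least `N - 1` states. -/
theorem le_card_of_exclusiveAccepts {τ : Type*} [Fintype τ] (X : NFA Unit τ)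
    (hX : X.HasSingleStart) {N : ℕ} (hN : 2 ≤ N)
    (h : ∀ k, 0 < k → k < N → List.replicate k () ∈ X.exclusiveAccepts)
    (hN' : List.replicate N () ∉ X.exclusiveAccepts) : N ≤ Fintype.card τ + 1 := by
  classical
  obtain ⟨s, hs⟩ := hX
  simp only [X.replicate_mem_exclusiveAccepts hs] at h hN'
  by_contra! hlt
  refine hN' ?_
  -- The window starts at `1` because nothing is assumed about the empty word.
  have := eq_of_linear_recurrence (m := Fintype.card τ) (b := X.transitionMatrix.charpoly.coeff)
    (c := X.acceptingCount s) (k₀ := 1) (by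
      rw [← Matrix.charpoly_natDegree_eq_dim X.transitionMatrix]
      exact X.transitionMatrix.charpoly_monic)
    (X.sum_charpoly_coeff_mul_acceptingCount s)
    (fun i hi => by rw [h _ (by omega) (by omega), h 1 one_pos (by omega)]) (N - 1)
  rwa [Nat.add_sub_cancel' (by omega), h 1 one_pos (by omega)] at this

/-- An initial state branching into cycles of lengths `p ∈ P`, each accepting off its base point,
together with `d` idle states. -/
def cyclesNFA (P : Finset ℕ) (d : ℕ) : NFA Unit (Option (Σ p : P, ZMod p) ⊕ Fin d) where
  step s _ := match s with
    | .inl none => {t | ∃ p, t = .inl (some ⟨p, 1⟩)}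
    | .inl (some ⟨p, i⟩) => {.inl (some ⟨p, i + 1⟩)}
    | .inr _ => ∅
  start := {.inl none}
  accept := {t | ∃ p i, i ≠ 0 ∧ t = .inl (some ⟨p, i⟩)}

theorem eval_cyclesNFA (P : Finset ℕ) (d k : ℕ) :
    (cyclesNFA P d).eval (List.replicate (k + 1) ()) =
      {t | ∃ p : P, t = .inl (some ⟨p, ((k + 1 : ℕ) : ZMod p)⟩)} := by
  induction k with
  | zero =>
    simp [eval, evalFrom, cyclesNFA, stepSet]
  | succ k ih =>
    rw [List.replicate_succ', eval_append_singleton, ih]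
    ext t
    simp [mem_stepSet, cyclesNFA]

theorem replicate_mem_cyclesNFA {P : Finset ℕ} (hP : ∀ p ∈ P, p.Prime) (d : ℕ) {k : ℕ}
    (hk : 0 < k) :
    List.replicate k () ∈ (cyclesNFA P d).accepts ↔ ¬ (∏ p ∈ P, p) ∣ k := by
  obtain ⟨k, rfl⟩ : ∃ j, k = j + 1 := ⟨k - 1, by omega⟩
  have hdvd : (∏ p ∈ P, p) ∣ k + 1 ↔ ∀ p ∈ P, p ∣ k + 1 :=
    ⟨fun h p hp => (Finset.dvd_prod_of_mem _ hp).trans h, fun h =>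
      Finset.prod_primes_dvd _ (fun p hp => (hP p hp).prime) h⟩
  rw [hdvd]
  change (∃ t ∈ (cyclesNFA P d).accept, t ∈ (cyclesNFA P d).eval _) ↔ _
  rw [eval_cyclesNFA]
  push Not
  simp only [← ZMod.natCast_eq_zero_iff]
  constructor
  · rintro ⟨_, ⟨p, i, hi, rfl⟩, q, hq⟩
    simp only [Sum.inl.injEq, Option.some.injEq, Sigma.mk.injEq] at hq
    obtain ⟨rfl, hq⟩ := hq
    obtain rfl := eq_of_heq hq
    exact ⟨p, p.2, hi⟩
  · rintro ⟨p, hp, h⟩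
    exact ⟨_, ⟨⟨p, hp⟩, _, h, rfl⟩, ⟨p, hp⟩, rfl⟩

theorem exists_NFA_prod_primes {P : Finset ℕ} (hP : ∀ p ∈ P, p.Prime) (hne : P.Nonempty) {n : ℕ}
    (hn : 1 + ∑ p ∈ P, p ≤ n) :
    ∃ (σ : Type) (_ : Fintype σ) (M : NFA Unit σ), Fintype.card σ = n ∧ M.HasSingleStart ∧
      ∀ (τ : Type) [Fintype τ] (X : NFA Unit τ), X.HasSingleStart →
        X.exclusiveAccepts = M.accepts → ∏ p ∈ P, p ≤ Fintype.card τ + 1 := by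
  have : ∀ p : P, NeZero (p : ℕ) := fun p => ⟨(hP p p.2).ne_zero⟩
  refine ⟨_, inferInstance, cyclesNFA P (n - (1 + ∑ p ∈ P, p)), ?_, ⟨_, rfl⟩, fun τ _ X hX h => ?_⟩
  · simp only [Fintype.card_sum, Fintype.card_option, Fintype.card_sigma, ZMod.card,
      Fintype.card_fin]
    rw [Finset.sum_coe_sort P fun p => p]
    omega
  · have htwo : 2 ≤ ∏ p ∈ P, p := by
      obtain ⟨p, hp⟩ := hne
      exact (hP p hp).two_le.trans (Nat.le_of_dvd
        (Finset.prod_pos fun q hq => (hP q hq).pos) (Finset.dvd_prod_of_mem _ hp))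
    refine X.le_card_of_exclusiveAccepts hX htwo (fun k hk hk' => ?_) ?_
    · rw [h, replicate_mem_cyclesNFA hP _ hk]
      exact Nat.not_dvd_of_pos_of_lt hk hk'
    · rw [h, replicate_mem_cyclesNFA hP _ (by omega)]
      simp

/-- For `n ≥ 2` some `n`-state automaton has no equivalent XNFA with a single state. -/
theorem exists_NFA_two_le {n : ℕ} (hn : 2 ≤ n) :
    ∃ (σ : Type) (_ : Fintype σ) (M : NFA Unit σ), Fintype.card σ = n ∧ M.HasSingleStart ∧
      ∀ (τ : Type) [Fintype τ] (X : NFA Unit τ), X.HasSingleStart →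
        X.exclusiveAccepts = M.accepts → 2 ≤ Fintype.card τ := by
  classical
  let s : Fin n := ⟨0, by omega⟩
  let t : Fin n := ⟨1, by omega⟩
  have hst : s ≠ t := by simp [s, t]
  let M : NFA Unit (Fin n) :=
    { step := fun x _ => if x = s then {t} else ∅, start := {s}, accept := {t} }
  refine ⟨Fin n, inferInstance, M, Fintype.card_fin n, ⟨s, rfl⟩, fun τ _ X hX h => ?_⟩
  by_contra! hlt
  obtain ⟨q, hq⟩ := hX
  have : Subsingleton τ := Fintype.card_le_one_iff_subsingleton.mp (by omega)
  have h₀ : List.replicate 0 () ∉ M.accepts := by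
    change ¬ ∃ x ∈ M.accept, x ∈ M.start
    simp [M, hst.symm]
  have h₁ : List.replicate 1 () ∈ M.accepts := by
    change ∃ x ∈ M.accept, x ∈ M.stepSet M.start ()
    simp [M, stepSet]
  rw [← h, X.replicate_mem_exclusiveAccepts hq] at h₀ h₁
  -- If the only state were accepting, the empty word would have exactly one accepting path.
  have hacc : X.accept = ∅ := by
    rw [Set.eq_empty_iff_forall_notMem]
    intro x hx
    obtain rfl := Subsingleton.elim x q
    have : (Finset.univ.filter (· ∈ X.accept)) = {x} := by
      ext y
      simp [Subsingleton.elim y x, hx]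
    apply h₀
    rw [acceptingCount, this]
    simp
  rw [acceptingCount, hacc] at h₁
  simp at h₁

end NFA

/-! ### Analytic estimates -/

open Filter in
theorem Chebyshev.eventually_div_four_le_theta : ∀ᶠ x : ℝ in atTop, x / 4 ≤ Chebyshev.theta x := by
  have h := (isLittleO_log_rpow_atTop (r := 1 / 2) (by norm_num)).bound
    (show (0 : ℝ) < 1 / 20 by norm_num)
  filter_upwards [h, eventually_ge_atTop 4] with x hx hx4
  rw [← Real.sqrt_eq_rpow, Real.norm_of_nonneg (Real.log_nonneg (by linarith)),
    Real.norm_of_nonneg (Real.sqrt_nonneg x)] at hx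
  have h₁ := Chebyshev.theta_ge' (x := x) (by linarith)
  have h₂ : Real.log (x + 2) ≤ 2 * Real.log x := by
    rw [← Real.log_rpow (by linarith)]
    exact Real.log_le_log (by linarith) (by norm_num; nlinarith)
  have h₃ := Real.log_two_gt_d9
  have h₄ : √x * √x = x := Real.mul_self_sqrt (by linarith)
  have h₅ : 2 * √x * Real.log x ≤ x / 10 := by
    nlinarith [mul_le_mul_of_nonneg_left hx (Real.sqrt_nonneg x)]
  have h₆ : √x ≤ x := Real.sqrt_le_iff.mpr ⟨by linarith, by nlinarith⟩
  nlinarith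

theorem sqrt_mul_log_ge_one {n : ℕ} (hn : 2 ≤ n) : 1 ≤ √((n : ℝ) * Real.log n) := by
  have h : (2 : ℝ) ≤ n := by exact_mod_cast hn
  have h₁ : Real.log 2 ≤ Real.log n := Real.log_le_log two_pos h
  have := Real.log_two_gt_d9
  rw [Real.one_le_sqrt]
  nlinarith

theorem log_le_sqrt_mul_log (n : ℕ) : Real.log n ≤ √((n : ℝ) * Real.log n) := by
  have h₀ : 0 ≤ Real.log n := Real.log_natCast_nonneg n
  have h₁ : Real.log n ≤ n := Real.log_le_self (Nat.cast_nonneg n)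
  apply Real.le_sqrt_of_sq_le
  nlinarith

theorem sqrt_mul_log_le (n : ℕ) : √((n : ℝ) * Real.log n) ≤ n := by
  have h₁ : Real.log n ≤ n := Real.log_le_self (Nat.cast_nonneg n)
  apply Real.sqrt_le_iff.mpr
  refine ⟨Nat.cast_nonneg n, ?_⟩
  nlinarith [(Nat.cast_nonneg n : (0 : ℝ) ≤ n)]

theorem two_mul_sq_add_le_exp {n L d : ℕ} (hn : 2 ≤ n)
    (hd : d * ⌈√((n : ℝ) * Real.log n)⌉₊ ≤ n)
    (hL : L ≤ Nat.lcmUpto ⌈√((n : ℝ) * Real.log n)⌉₊ * n ^ d) :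
    ((2 * n ^ 2 + L : ℕ) : ℝ) ≤ Real.exp (14 * √((n : ℝ) * Real.log n)) := by
  have hs := sqrt_mul_log_ge_one hn
  have hlog := log_le_sqrt_mul_log n
  have hn' : (2 : ℝ) ≤ n := by exact_mod_cast hn
  have hlog₀ : 0 ≤ Real.log n := Real.log_natCast_nonneg n
  have hsq : √((n : ℝ) * Real.log n) * √((n : ℝ) * Real.log n) = n * Real.log n :=
    Real.mul_self_sqrt (by positivity)
  have hT : (⌈√((n : ℝ) * Real.log n)⌉₊ : ℝ) ≤ 2 * √((n : ℝ) * Real.log n) := by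
    linarith [Nat.ceil_lt_add_one (Real.sqrt_nonneg ((n : ℝ) * Real.log n))]
  have hT' := Nat.le_ceil √((n : ℝ) * Real.log n)
  generalize √((n : ℝ) * Real.log n) = s at *
  generalize ⌈s⌉₊ = T at *
  have hexp : ∀ m : ℕ, (n : ℝ) ^ m = Real.exp (m * Real.log n) := fun m => by
    rw [Real.exp_nat_mul, Real.exp_log (by linarith)]
  -- `ψ(T) ≤ 6T` and `T ≤ 2s` give the `12`.
  have h₁ : (Nat.lcmUpto T : ℝ) ≤ Real.exp (12 * s) := by
    rw [← Real.log_le_iff_le_exp (by exact_mod_cast Nat.lcmUpto_pos T),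
      ← Chebyshev.psi_eq_log_lcmUpto]
    refine (Chebyshev.psi_le_const_mul_self (Nat.cast_nonneg T)).trans ?_
    have : Real.log 4 ≤ 2 := by
      rw [show (4 : ℝ) = 2 ^ 2 by norm_num, Real.log_pow]
      have := Real.log_two_lt_d9
      push_cast
      linarith
    have hT₀ : (0 : ℝ) ≤ T := Nat.cast_nonneg T
    nlinarith
  have h₂ : (n : ℝ) ^ d ≤ Real.exp s := by
    rw [hexp]
    apply Real.exp_le_exp.mpr
    have hd' : (d : ℝ) * T ≤ n := by exact_mod_cast hd
    have hd₀ : (0 : ℝ) ≤ d := Nat.cast_nonneg d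
    -- Multiplying by `log n` gives `d log n * s ≤ n log n = s²`; cancel `s`.
    have h₃ : d * s ≤ n := (mul_le_mul_of_nonneg_left hT' hd₀).trans hd'
    have h₄ : d * Real.log n * s ≤ s * s := by
      rw [hsq]
      nlinarith
    exact le_of_mul_le_mul_right h₄ (by linarith)
  have h₃ : (L : ℝ) ≤ Real.exp (13 * s) := by
    calc (L : ℝ) ≤ Nat.lcmUpto T * (n : ℝ) ^ d := by exact_mod_cast hL
      _ ≤ Real.exp (12 * s) * Real.exp s := by gcongr
      _ = Real.exp (13 * s) := by rw [← Real.exp_add]; ring_nf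
  have h₄ : 2 * (n : ℝ) ^ 2 ≤ Real.exp (13 * s) := by
    calc 2 * (n : ℝ) ^ 2 ≤ n ^ 3 := by nlinarith [sq_nonneg (n : ℝ)]
      _ ≤ Real.exp (13 * s) := by
        rw [hexp]
        apply Real.exp_le_exp.mpr
        push_cast
        linarith
  have h₅ : 2 ≤ Real.exp s := by linarith [Real.add_one_le_exp s]
  push_cast
  calc 2 * (n : ℝ) ^ 2 + L ≤ 2 * Real.exp (13 * s) := by linarith
    _ ≤ Real.exp s * Real.exp (13 * s) := by gcongr
    _ = Real.exp (14 * s) := by rw [← Real.exp_add]; ring_nf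

open Filter in
/-- A lower bound for Landau's function: primes of sum less than `n` whose product is
`exp (Ω (√(n ln n)))`. -/
theorem eventually_exists_primes_sum_le :
    ∀ᶠ n : ℕ in atTop, ∃ P : Finset ℕ, (∀ p ∈ P, p.Prime) ∧ P.Nonempty ∧ 1 + ∑ p ∈ P, p ≤ n ∧
      Real.exp (1 / 32 * √((n : ℝ) * Real.log n)) + 1 ≤ ((∏ p ∈ P, p : ℕ) : ℝ) := by
  have hnat : Tendsto (fun n : ℕ => (n : ℝ)) atTop atTop := tendsto_natCast_atTop_atTop
  have hlog : Tendsto (fun n : ℕ => Real.log n) atTop atTop := Real.tendsto_log_atTop.comp hnat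
  have hx : Tendsto (fun n : ℕ => 1 / 4 * √((n : ℝ) * Real.log n)) atTop atTop :=
    (Real.tendsto_sqrt_atTop.comp (hnat.atTop_mul_atTop₀ hlog)).const_mul_atTop (by norm_num)
  filter_upwards [hx.eventually Chebyshev.eventually_div_four_le_theta,
    hx.eventually (Chebyshev.eventually_primeCounting_le one_pos), hx.eventually_ge_atTop 8,
    hlog.eventually_ge_atTop 16, eventually_ge_atTop 2] with n hθ hπ hx₈ hlog₁₆ hn
  have hn' : (2 : ℝ) ≤ n := by exact_mod_cast hn
  have hsq : √((n : ℝ) * Real.log n) * √((n : ℝ) * Real.log n) = n * Real.log n :=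
    Real.mul_self_sqrt (by positivity)
  have hsqrt : √(n : ℝ) ≤ 1 / 4 * √((n : ℝ) * Real.log n) := by
    rw [Real.sqrt_mul (by linarith)]
    have : 4 ≤ √(Real.log n) := Real.le_sqrt_of_sq_le (by linarith)
    nlinarith [Real.sqrt_nonneg (n : ℝ)]
  generalize √((n : ℝ) * Real.log n) = s at *
  set x := 1 / 4 * s with hxs
  have hlogx : Real.log n / 2 ≤ Real.log x := by
    rw [← Real.log_sqrt (by linarith)]
    exact Real.log_le_log (Real.sqrt_pos.mpr (by linarith)) hsqrt
  have hlogθ : Real.log ((∏ p ∈ Nat.primesLE ⌊x⌋₊, p : ℕ) : ℝ) = Chebyshev.theta x := by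
    rw [Chebyshev.theta_eq_sum_primesLE, Nat.cast_prod, Real.log_prod]
    intro p hp
    exact_mod_cast (Nat.prime_of_mem_primesLE hp).ne_zero
  refine ⟨Nat.primesLE ⌊x⌋₊, fun p hp => Nat.prime_of_mem_primesLE hp, ⟨2, ?_⟩, ?_, ?_⟩
  · rw [Nat.mem_primesLE]
    exact ⟨Nat.le_floor (by push_cast; linarith), Nat.prime_two⟩
  -- The sum is at most `π(x) x ≤ 3x² / log x ≤ 6x² / log n = 3n/8`, using `log x ≥ log n / 2`.
  · have hsum : ((∑ p ∈ Nat.primesLE ⌊x⌋₊, p : ℕ) : ℝ) ≤ (Nat.primeCounting ⌊x⌋₊) * x := by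
      rw [← Nat.primesLE_card_eq_primeCounting, ← nsmul_eq_mul, Nat.cast_sum]
      refine Finset.sum_le_card_nsmul _ _ _ fun p hp => ?_
      exact (Nat.le_floor_iff (by linarith)).mp (Nat.le_of_mem_primesLE hp)
    have h4 : Real.log 4 ≤ 2 := by
      rw [show (4 : ℝ) = 2 ^ 2 by norm_num, Real.log_pow]
      have := Real.log_two_lt_d9
      push_cast
      linarith
    have hπ' : (Nat.primeCounting ⌊x⌋₊ : ℝ) * Real.log x ≤ 3 * x := by
      rw [le_div_iff₀ (by linarith)] at hπ
      nlinarith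
    have h₁ : (Nat.primeCounting ⌊x⌋₊ : ℝ) * x * (Real.log n / 2) ≤ 3 / 8 * n * (Real.log n / 2) := by
      calc (Nat.primeCounting ⌊x⌋₊ : ℝ) * x * (Real.log n / 2)
          ≤ (Nat.primeCounting ⌊x⌋₊ : ℝ) * x * Real.log x := by gcongr
        _ ≤ 3 * x * x := by nlinarith
        _ = 3 / 8 * n * (Real.log n / 2) := by
          rw [hxs]; linear_combination 3 / 16 * hsq
    have h₂ := le_of_mul_le_mul_right h₁ (by linarith)
    have h₃ : ((1 + ∑ p ∈ Nat.primesLE ⌊x⌋₊, p : ℕ) : ℝ) ≤ n := by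
      rw [Nat.cast_add, Nat.cast_one]
      linarith
    exact_mod_cast h₃
  · have hpos : (0 : ℝ) < (∏ p ∈ Nat.primesLE ⌊x⌋₊, p : ℕ) := by
      exact_mod_cast Finset.prod_pos fun p hp => (Nat.prime_of_mem_primesLE hp).pos
    rw [← Real.exp_log hpos, hlogθ]
    -- `θ(x) ≥ x/4 = s/16`; half of this exponent is given up to absorb the `+ 1`.
    have h₁ : Real.exp (1 / 32 * s) * Real.exp (1 / 32 * s) ≤ Real.exp (Chebyshev.theta x) := by
      rw [← Real.exp_add]
      exact Real.exp_le_exp.mpr (by linarith)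
    have h₂ : 2 ≤ Real.exp (1 / 32 * s) := by linarith [Real.add_one_le_exp (1 / 32 * s)]
    nlinarith

/-! ### The optimal number of states -/

/-- Every `n`-state unary automaton has an equivalent XNFA with at most `k` states. -/
def XNFASuffice (n k : ℕ) : Prop :=
  ∀ (σ : Type) [Fintype σ] (M : NFA Unit σ), Fintype.card σ = n → M.HasSingleStart →
    ∃ (τ : Type) (_ : Fintype τ) (X : NFA Unit τ), X.HasSingleStart ∧
      Fintype.card τ ≤ k ∧ X.exclusiveAccepts = M.accepts

theorem exists_XNFASuffice_le_exp {n : ℕ} (hn : 2 ≤ n) :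
    ∃ k : ℕ, XNFASuffice n k ∧ (k : ℝ) ≤ Real.exp (14 * √((n : ℝ) * Real.log n)) := by
  refine ⟨⌊Real.exp (14 * √((n : ℝ) * Real.log n))⌋₊, fun σ _ M hσ _ => ?_,
    Nat.floor_le (Real.exp_pos _).le⟩
  subst hσ
  obtain ⟨L, d, -, hd, hL, τ, hτ, X, hX, hcard, h⟩ :=
    M.exists_XNFA ⌈√((Fintype.card σ : ℝ) * Real.log (Fintype.card σ))⌉₊
  exact ⟨τ, hτ, X, hX, hcard.trans (Nat.le_floor (two_mul_sq_add_le_exp hn hd hL)), h⟩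

theorem XNFASuffice.two_le {n k : ℕ} (hn : 2 ≤ n) (h : XNFASuffice n k) : 2 ≤ k := by
  obtain ⟨σ, _, M, hσ, hM, hX⟩ := NFA.exists_NFA_two_le hn
  obtain ⟨τ, _, X, hs, hk, hacc⟩ := h σ M hσ hM
  exact (hX τ X hs hacc).trans hk

/-- Prime cycles handle `n ≥ n₀`; below `n₀`, `c` is so small that the bound is at most `2`, and `2
≤ k` always. -/
theorem exists_exp_le_of_XNFASuffice : ∃ c : ℝ, 0 < c ∧ ∀ n k : ℕ, 2 ≤ n → XNFASuffice n k →
    Real.exp (c * √((n : ℝ) * Real.log n)) ≤ k := by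
  obtain ⟨n₀, h₀⟩ := Filter.eventually_atTop.mp eventually_exists_primes_sum_le
  have hlog : 0 < Real.log 2 := Real.log_pos one_lt_two
  refine ⟨min (1 / 32) (Real.log 2 / (n₀ + 1)), by positivity, fun n k hn h => ?_⟩
  have hs := Real.sqrt_nonneg ((n : ℝ) * Real.log n)
  rcases le_or_gt n₀ n with hle | hlt
  · obtain ⟨P, hP, hne, hsum, hprod⟩ := h₀ n hle
    obtain ⟨σ, _, M, hσ, hM, hX⟩ := NFA.exists_NFA_prod_primes hP hne hsum
    obtain ⟨τ, _, X, hs', hk, hacc⟩ := h σ M hσ hM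
    have h₁ : ((∏ p ∈ P, p : ℕ) : ℝ) ≤ k + 1 := by
      exact_mod_cast (hX τ X hs' hacc).trans (Nat.add_le_add_right hk 1)
    have h₂ : Real.exp (min (1 / 32) (Real.log 2 / (n₀ + 1)) * √((n : ℝ) * Real.log n)) ≤
        Real.exp (1 / 32 * √((n : ℝ) * Real.log n)) := by
      gcongr
      exact min_le_left _ _
    linarith
  · have h₁ : min (1 / 32) (Real.log 2 / (n₀ + 1)) * √((n : ℝ) * Real.log n) ≤ Real.log 2 := by
      have hn₀ : √((n : ℝ) * Real.log n) ≤ n₀ + 1 :=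
        (sqrt_mul_log_le n).trans (by exact_mod_cast (hlt.le.trans (Nat.le_succ _)))
      calc min (1 / 32) (Real.log 2 / (n₀ + 1)) * √((n : ℝ) * Real.log n)
          ≤ Real.log 2 / (n₀ + 1) * (n₀ + 1) := by
            gcongr
            exact min_le_right _ _
        _ = Real.log 2 := by field_simp
    calc _ ≤ Real.exp (Real.log 2) := Real.exp_le_exp.mpr h₁
      _ = 2 := Real.exp_log two_pos
      _ ≤ k := by exact_mod_cast h.two_le hn

theorem mainTheorem9 :
    ∃ f : ℕ → ℕ,
      -- `f n = exp (Θ (√(n ln n)))`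
      (∃ c C : ℝ, 0 < c ∧ 0 < C ∧ ∀ n : ℕ, 2 ≤ n →
        Real.exp (c * Real.sqrt (n * Real.log n)) ≤ (f n : ℝ) ∧
        (f n : ℝ) ≤ Real.exp (C * Real.sqrt (n * Real.log n))) ∧
      ∀ n : ℕ, 2 ≤ n →
        -- `f n` states suffice for an XNFA to accept the language of any unary `n`-state NFA
        (∀ (σ : Type) [Fintype σ] (M : NFA Unit σ), Fintype.card σ = n → M.HasSingleStart →
          ∃ (τ : Type) (_ : Fintype τ) (X : NFA Unit τ), X.HasSingleStart ∧
            Fintype.card τ ≤ f n ∧ X.exclusiveAccepts = M.accepts) ∧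
        -- and for some unary `n`-state NFA no fewer states suffice
        (∃ (σ : Type) (_ : Fintype σ) (M : NFA Unit σ), Fintype.card σ = n ∧ M.HasSingleStart ∧
          ∀ (τ : Type) [Fintype τ] (X : NFA Unit τ), X.HasSingleStart →
            X.exclusiveAccepts = M.accepts → f n ≤ Fintype.card τ) := by
  classical
  obtain ⟨c, hc, hlow⟩ := exists_exp_le_of_XNFASuffice
  have hex : ∀ n, 2 ≤ n → ∃ k, XNFASuffice n k := fun n hn =>
    (exists_XNFASuffice_le_exp hn).imp fun _ h => h.1
  refine ⟨fun n => sInf {k | XNFASuffice n k}, ⟨c, 14, hc, by norm_num, fun n hn => ⟨?_, ?_⟩⟩,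
    fun n hn => ⟨Nat.sInf_mem (hex n hn), ?_⟩⟩
  · exact hlow n _ hn (Nat.sInf_mem (hex n hn))
  · obtain ⟨k, hk, hle⟩ := exists_XNFASuffice_le_exp hn
    exact le_trans (by exact_mod_cast Nat.sInf_le hk) hle
  · have htwo : 2 ≤ sInf {k | XNFASuffice n k} :=
      XNFASuffice.two_le hn (Nat.sInf_mem (hex n hn))
    -- Failure of `m - 1` yields the witness for (ii); `2 ≤ m` keeps the subtraction from
    -- truncating.
    have hmin : ¬ XNFASuffice n (sInf {k | XNFASuffice n k} - 1) :=
      Nat.notMem_of_lt_sInf (s := {k | XNFASuffice n k}) (by omega)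
    change ∃ σ, ∃ _ : Fintype σ, ∃ M : NFA Unit σ, Fintype.card σ = n ∧ M.HasSingleStart ∧
      ∀ (τ : Type) [Fintype τ] (X : NFA Unit τ), X.HasSingleStart →
        X.exclusiveAccepts = M.accepts → sInf {k | XNFASuffice n k} ≤ Fintype.card τ
    generalize sInf {k | XNFASuffice n k} = m at htwo hmin ⊢
    unfold XNFASuffice at hmin
    push Not at hmin
    obtain ⟨σ, hσ, M, hcard, hM, h⟩ := hmin
    refine ⟨σ, hσ, M, hcard, hM, fun τ _ X hX hacc => ?_⟩
    by_contra! hlt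
    exact h τ inferInstance X hX (by omega) hacc
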